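/- Fix an integer $m\ge 1$. For each $n\ge 0$ consider a $GI/M/m/n$ queue: $m$ servers, $n$ waiting places, i.i.d. interarrival times with distribution $A=A_n$ on $[0,\infty)$ of finite positive mean $1/\lambda$, and independent exponential service times of rate $\mu=\mu_n>0$; a customer who finds all $m+n$ places taken is lost. Let $\varrho=\lambda/(m\mu)$ be the load and $\varrho_k(n)=\int_0^\infty(\mu m x)^k\,\mathrm{d}A(x)$ for $k=2,3$ ($A$ and $\mu$ may depend on $n$). For each $n$ suppose $\varrho=1-\varepsilon$ with $\varepsilon=\varepsilon_n>0$, where $\varepsilon\to0$ and $\varepsilon n\to C$ as $n\to\infty$. Assume that the sequence $\varrho_3(n)$ is finite and bounded and that the limit $\widetilde\varrho_2=\lim_{n\to\infty}\varrho_2(n)$ exists. Then for every $n$ the Markov chain of the number of customers found by successive arrivals has exactly one stationary distribution; let $p_{m,n}$, the stationary loss probability, be its mass at $m+n$. As $n\to\infty$: (i) if $C>0$, then $$p_{m,n}=\frac{\varepsilon\,\mathrm{e}^{-2C/\widetilde\varrho_2}}{1-\mathrm{e}^{-2C/\widetilde\varrho_2}}\,[1+o(1)];$$ (ii) if $C=0$,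 then $$p_{m,n}=\frac{\widetilde\varrho_2}{2n}+o\Big(\frac1n\Big).$$ Thus the asymptotic expression in terms of $\varepsilon$, $C$, $\widetilde\varrho_2$ and $n$ is the same for every $m\ge1$, in particular the same as for the $GI/M/1/n$ queue. -/

import Mathlib

open Filter Topology MeasureTheory

noncomputable section

namespace GIMmn

/-- `A` is the distribution of an interarrival time: a probability measure carried by `[0, ∞)`
whose mean is finite and positive. -/
structure IsInterarrivalLaw (A : Measure ℝ) : Prop where
  isProbabilityMeasure : IsProbabilityMeasure A
  nonneg : A (Set.Iio 0) = 0
  integrable : Integrable (fun x : ℝ => x) A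
  mean_pos : 0 < ∫ x, x ∂A

/-- The arrival rate, the reciprocal of the expected interarrival time. -/
def arrivalRate (A : Measure ℝ) : ℝ := (∫ x, x ∂A)⁻¹

/-- The load of a system with `m` servers, each of service rate `μ`. -/
def load (m : ℕ) (μ : ℝ) (A : Measure ℝ) : ℝ := arrivalRate A / (m * μ)

/-- The normalized moment `∫ (μ m x) ^ k dA(x)` of the interarrival time. -/
def normalizedMoment (k m : ℕ) (μ : ℝ) (A : Measure ℝ) : ℝ := ∫ x, (μ * m * x) ^ k ∂A

/-- The generator of the number of customers, at most `N`, between two arrivals: with `j`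
customers present, `min j m` servers are busy, so that `j` jumps to `j - 1` at rate
`μ * min j m`. -/
def serviceGenerator (m N : ℕ) (μ : ℝ) : Matrix (Fin (N + 1)) (Fin (N + 1)) ℝ :=
  fun j k =>
    if k = j then -(μ * (min (j : ℕ) m : ℕ))
    else if (k : ℕ) + 1 = j then μ * (min (j : ℕ) m : ℕ)
    else 0

/-- The number of customers just after an arrival that finds `i` customers in a system of
capacity `N`: the arriving customer is admitted if `i < N` and is lost if `i = N`. -/
def afterArrival (N : ℕ) (i : Fin (N + 1)) : Fin (N + 1) :=
  ⟨min ((i : ℕ) + 1) N, Nat.lt_succ_of_le (min_le_right _ _)⟩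

/-- The transition matrix of the number of customers found by successive arrivals in the
`GI/M/m/n` queue (`m` servers, `n` waiting places, hence capacity `m + n`): an arrival takes place,
and then services are completed during an interarrival time `x` of law `A`. -/
def transitionMatrix (m n : ℕ) (μ : ℝ) (A : Measure ℝ) :
    Matrix (Fin (m + n + 1)) (Fin (m + n + 1)) ℝ :=
  fun i k => ∫ x, NormedSpace.exp (x • serviceGenerator m (m + n) μ) (afterArrival (m + n) i) k ∂A

/-- `w` is a stationary probability distribution of the Markov chain with transition matrix `P`. -/
def IsStationaryLaw {ι : Type*} [Fintype ι] (P : Matrix ι ι ℝ) (w : ι → ℝ) : Prop :=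
  w ∈ stdSimplex ℝ ι ∧ Matrix.vecMul w P = w

/-- The stationary loss probability `p_{m,n}` of the `GI/M/m/n` queue: the probability, under the
stationary law of the number of customers found by an arrival, that all `m + n` places are taken.
(The stationary law is picked by `Classical.epsilon`, to be used where it exists uniquely.) -/
def lossProb (m n : ℕ) (μ : ℝ) (A : Measure ℝ) : ℝ :=
  Classical.epsilon (IsStationaryLaw (transitionMatrix m n μ A)) (Fin.last (m + n))

end GIMmn

end

/-!
The proof tests stationarity of the embedded chain against two functions of the number of
customers, and never computes the stationary law.

Write `N = m + n`, let `S = μ m x` be the normalized interarrival time, `δ = E[S] - 1 = ε / (1 - ε)`,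
and let `p` be the loss probability.

* Tested against `j ↦ j`, stationarity is rate conservation: the expected service capacity left
  unused during an interarrival time, because fewer than `m` customers are present, equals `δ + p`
  (`integral_idleMean`).
* The function `j ↦ z ^ j` with `z = (1 - u)⁻¹` is an eigenvector of the service process as long as
  all servers are busy. With `u = 2 δ / ϱ₂(n)` the Laplace transform of `S` at `u` equals `1 - u` up
  to `O(u ^ 3)`, which makes `z ^ j` harmonic up to that order away from the boundaries. At the upper
  boundary the lost customers contribute `u z ^ (N + 1) p`, at the lower one the unused capacity
  contributes `u (δ + p)` up to small errors. So `z ^ N p = δ + p` up to errors that are made explicit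
  in `abs_loss_balance_le`. The number of servers enters these errors only.

The delicate error comes from the factor `exp (-u S)` inside the lower boundary term: it is
controlled by the mean of `S` times the unused capacity. As the unused capacity is at most `S`, this
mean is at most `K (δ + p) + ϱ₃(n) / K` for every `K > 0` (`le_integral_exp_mul_idleMean`), and
`K = √n` makes the error negligible both against `δ` and, in its coefficient of `p`, against
`z ^ N - 1`, which is of order `n u`.

Hence `p (z ^ N - 1) ~ δ ~ ε`, while `n u → κ = 2 C / ϱ₂` and
`(z ^ N - 1) / (n u) → (exp κ - 1) / κ`, read as `1` for `κ = 0`. This gives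
`n p → (ϱ₂ / 2) κ / (exp κ - 1)` in both regimes (`tendsto_lossProb_mul`). The exponential quotient
is expressed as `dslope Real.exp 0`, which is continuous at `0`, so that no case distinction is
needed before the very end.

The matrix exponential is handled through its forward and backward equations only; the latter give
positivity by induction on the number of customers, since the generator is lower bidiagonal.
Existence and uniqueness of the stationary law follow because the absolute value of a left fixed
vector of a stochastic matrix is fixed, and because the state `0` is reached from everywhere in one
step.
-/

namespace GIMmn

open scoped Matrix

/-! ### The semigroup of the service process -/

section Semigroup

/-- The derivative of the matrix exponential, applied to a vector, in the form of the backward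
equation. -/
theorem hasDerivAt_exp_smul_mulVec {ι : Type*} [Fintype ι] [DecidableEq ι] (Q : Matrix ι ι ℝ)
    (f : ι → ℝ) (x : ℝ) (i : ι) :
    HasDerivAt (fun x : ℝ => (NormedSpace.exp (x • Q) *ᵥ f) i)
      ((Q *ᵥ (NormedSpace.exp (x • Q) *ᵥ f)) i) x := by
  let _ : NormedRing (Matrix ι ι ℝ) := Matrix.linftyOpNormedRing
  let _ : NormedAlgebra ℝ (Matrix ι ι ℝ) := Matrix.linftyOpNormedAlgebra
  have h := hasDerivAt_exp_smul_const' (𝕂 := ℝ) Q x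
  let L : Matrix ι ι ℝ →ₗ[ℝ] ℝ :=
    { toFun := fun M => (M *ᵥ f) i
      map_add' := fun M M' => by simp [Matrix.add_mulVec]
      map_smul' := fun c M => by simp [Matrix.smul_mulVec] }
  have := (LinearMap.toContinuousLinearMap L).hasFDerivAt.comp_hasDerivAt x h
  rw [Matrix.mulVec_mulVec]
  exact this

/-- The derivative of the matrix exponential, applied to a vector, in the form of the forward
equation. -/
theorem hasDerivAt_exp_smul_mulVec' {ι : Type*} [Fintype ι] [DecidableEq ι] (Q : Matrix ι ι ℝ)
    (f : ι → ℝ) (x : ℝ) (i : ι) :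
    HasDerivAt (fun x : ℝ => (NormedSpace.exp (x • Q) *ᵥ f) i)
      ((NormedSpace.exp (x • Q) *ᵥ (Q *ᵥ f)) i) x := by
  let _ : NormedRing (Matrix ι ι ℝ) := Matrix.linftyOpNormedRing
  let _ : NormedAlgebra ℝ (Matrix ι ι ℝ) := Matrix.linftyOpNormedAlgebra
  have h := hasDerivAt_exp_smul_const (𝕂 := ℝ) Q x
  let L : Matrix ι ι ℝ →ₗ[ℝ] ℝ :=
    { toFun := fun M => (M *ᵥ f) i
      map_add' := fun M M' => by simp [Matrix.add_mulVec]
      map_smul' := fun c M => by simp [Matrix.smul_mulVec] }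
  have := (LinearMap.toContinuousLinearMap L).hasFDerivAt.comp_hasDerivAt x h
  rw [Matrix.mulVec_mulVec]
  exact this

theorem serviceGenerator_mulVec_zero (m N : ℕ) (μ : ℝ) (f : Fin (N + 1) → ℝ) :
    (serviceGenerator m N μ *ᵥ f) 0 = 0 := by
  simp only [Matrix.mulVec, dotProduct, serviceGenerator]
  apply Finset.sum_eq_zero
  intro k _
  simp

/-- The generator acts as a difference operator, weighted by the total service rate. -/
theorem serviceGenerator_mulVec_succ (m N : ℕ) (μ : ℝ) (f : Fin (N + 1) → ℝ) (j : ℕ)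
    (hj : j + 1 < N + 1) :
    (serviceGenerator m N μ *ᵥ f) ⟨j + 1, hj⟩ =
      μ * (min (j + 1) m : ℕ) * (f ⟨j, by omega⟩ - f ⟨j + 1, hj⟩) := by
  simp only [Matrix.mulVec, dotProduct, serviceGenerator]
  have hne : (⟨j, by omega⟩ : Fin (N + 1)) ≠ ⟨j + 1, hj⟩ := by simp [Fin.ext_iff]
  rw [Fintype.sum_eq_add _ _ hne]
  · simp only [Fin.ext_iff]
    simp
    ring
  · rintro k ⟨h1, h2⟩
    have h1' : ¬ ((k : ℕ) = j) := fun h => h1 (by ext; simpa using h)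
    simp [h2, h1']

/-- The solution of `g' = q (φ - g)` with `φ > 0` and a nonnegative initial value is positive, since
`exp (q x) g x` increases strictly. -/
theorem pos_of_hasDerivAt_linear {g φ : ℝ → ℝ} {q : ℝ} (hq : 0 < q)
    (hg : ∀ x, HasDerivAt g (q * (φ x - g x)) x) (h0 : 0 ≤ g 0) (hφ : ∀ x, 0 < x → 0 < φ x)
    {x : ℝ} (hx : 0 < x) : 0 < g x := by
  have hd : ∀ y, HasDerivAt (fun y => Real.exp (q * y) * g y) (q * Real.exp (q * y) * φ y) y := by
    intro y
    have h1 : HasDerivAt (fun y : ℝ => Real.exp (q * y)) (Real.exp (q * y) * (q * 1)) y :=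
      ((hasDerivAt_id y).const_mul q).exp
    exact (h1.mul (hg y)).congr_deriv (by ring)
  have hm : StrictMonoOn (fun y => Real.exp (q * y) * g y) (Set.Ici 0) := by
    apply strictMonoOn_of_deriv_pos (convex_Ici 0)
      (fun y _ => (hd y).continuousAt.continuousWithinAt)
    intro y hy
    rw [interior_Ici, Set.mem_Ioi] at hy
    rw [(hd y).deriv]
    have := hφ y hy
    positivity
  have := hm (Set.self_mem_Ici) (Set.mem_Ici.2 hx.le) hx
  simp only [mul_zero, Real.exp_zero, one_mul] at this
  exact (mul_pos_iff_of_pos_left (Real.exp_pos _)).1 (h0.trans_lt this)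

theorem nonneg_of_hasDerivAt_linear {g φ : ℝ → ℝ} {q : ℝ} (hq : 0 ≤ q)
    (hg : ∀ x, HasDerivAt g (q * (φ x - g x)) x) (h0 : 0 ≤ g 0) (hφ : ∀ x, 0 ≤ x → 0 ≤ φ x)
    {x : ℝ} (hx : 0 ≤ x) : 0 ≤ g x := by
  have hd : ∀ y, HasDerivAt (fun y => Real.exp (q * y) * g y) (q * Real.exp (q * y) * φ y) y := by
    intro y
    have h1 : HasDerivAt (fun y : ℝ => Real.exp (q * y)) (Real.exp (q * y) * (q * 1)) y :=
      ((hasDerivAt_id y).const_mul q).exp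
    exact (h1.mul (hg y)).congr_deriv (by ring)
  have hm : MonotoneOn (fun y => Real.exp (q * y) * g y) (Set.Ici 0) := by
    apply monotoneOn_of_deriv_nonneg (convex_Ici 0)
      (fun y _ => (hd y).continuousAt.continuousWithinAt)
      (fun y _ => (hd y).differentiableAt.differentiableWithinAt)
    intro y hy
    rw [interior_Ici, Set.mem_Ioi] at hy
    rw [(hd y).deriv]
    have := hφ y hy.le
    positivity
  have := hm (Set.self_mem_Ici) (Set.mem_Ici.2 hx) hx
  simp only [mul_zero, Real.exp_zero, one_mul] at this
  exact (mul_nonneg_iff_of_pos_left (Real.exp_pos _)).1 (h0.trans this)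

variable {m N : ℕ} {μ : ℝ}

theorem exp_serviceGenerator_mulVec_nonneg (hμ : 0 ≤ μ) {f : Fin (N + 1) → ℝ} (hf : ∀ j, 0 ≤ f j)
    {x : ℝ} (hx : 0 ≤ x) (i : Fin (N + 1)) :
    0 ≤ (NormedSpace.exp (x • serviceGenerator m N μ) *ᵥ f) i := by
  obtain ⟨j, hj⟩ := i
  induction j generalizing x with
  | zero =>
    refine nonneg_of_hasDerivAt_linear (q := 0) (φ := 0)
      (g := fun x : ℝ => (NormedSpace.exp (x • serviceGenerator m N μ) *ᵥ f) ⟨0, hj⟩) le_rfl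
      (fun y => ?_) (by simpa using hf _) (fun _ _ => le_rfl) hx
    have := hasDerivAt_exp_smul_mulVec (serviceGenerator m N μ) f y 0
    rw [serviceGenerator_mulVec_zero] at this
    simpa using this
  | succ j ih =>
    refine nonneg_of_hasDerivAt_linear (q := μ * (min (j + 1) m : ℕ))
      (g := fun x : ℝ => (NormedSpace.exp (x • serviceGenerator m N μ) *ᵥ f) ⟨j + 1, hj⟩)
      (φ := fun x : ℝ => (NormedSpace.exp (x • serviceGenerator m N μ) *ᵥ f) ⟨j, by omega⟩)
      (by positivity) (fun y => ?_) (by simpa using hf _) (fun y hy => ih hy _) hx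
    have := hasDerivAt_exp_smul_mulVec (serviceGenerator m N μ) f y ⟨j + 1, hj⟩
    rwa [serviceGenerator_mulVec_succ] at this

theorem exp_serviceGenerator_mulVec_mono (hμ : 0 ≤ μ) {f g : Fin (N + 1) → ℝ}
    (hfg : ∀ j, f j ≤ g j) {x : ℝ} (hx : 0 ≤ x) (i : Fin (N + 1)) :
    (NormedSpace.exp (x • serviceGenerator m N μ) *ᵥ f) i ≤
      (NormedSpace.exp (x • serviceGenerator m N μ) *ᵥ g) i := by
  have := exp_serviceGenerator_mulVec_nonneg (m := m) hμ (f := g - f)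
    (fun j => sub_nonneg.2 (hfg j)) hx i
  rw [Matrix.mulVec_sub] at this
  exact sub_nonneg.1 this

theorem exp_serviceGenerator_mulVec_const (c : ℝ) (x : ℝ) (i : Fin (N + 1)) :
    (NormedSpace.exp (x • serviceGenerator m N μ) *ᵥ fun _ => c) i = c := by
  have h0 : serviceGenerator m N μ *ᵥ (fun _ => c) = 0 := by
    ext ⟨j, hj⟩
    cases j with
    | zero => exact serviceGenerator_mulVec_zero m N μ _
    | succ j => rw [serviceGenerator_mulVec_succ]; simp
  have hd : ∀ y, HasDerivAt
      (fun y : ℝ => (NormedSpace.exp (y • serviceGenerator m N μ) *ᵥ fun _ => c) i) 0 y := by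
    intro y
    simpa [h0] using hasDerivAt_exp_smul_mulVec' (serviceGenerator m N μ) (fun _ => c) y i
  have := is_const_of_deriv_eq_zero (fun y => (hd y).differentiableAt) (fun y => (hd y).deriv) x 0
  simpa using this

theorem exp_serviceGenerator_nonneg (hμ : 0 ≤ μ) {x : ℝ} (hx : 0 ≤ x) (i k : Fin (N + 1)) :
    0 ≤ NormedSpace.exp (x • serviceGenerator m N μ) i k := by
  simpa using exp_serviceGenerator_mulVec_nonneg (m := m) hμ (f := Pi.single k 1)
    (fun j => (Pi.single_nonneg.2 zero_le_one : (0 : Fin (N + 1) → ℝ) ≤ Pi.single k 1) j) hx i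

theorem sum_exp_serviceGenerator (x : ℝ) (i : Fin (N + 1)) :
    ∑ k, NormedSpace.exp (x • serviceGenerator m N μ) i k = 1 := by
  simpa [Matrix.mulVec, dotProduct] using
    exp_serviceGenerator_mulVec_const (m := m) (N := N) (μ := μ) 1 x i

theorem exp_serviceGenerator_le_one (hμ : 0 ≤ μ) {x : ℝ} (hx : 0 ≤ x) (i k : Fin (N + 1)) :
    NormedSpace.exp (x • serviceGenerator m N μ) i k ≤ 1 := by
  rw [← sum_exp_serviceGenerator (m := m) (μ := μ) x i]
  exact Finset.single_le_sum (f := fun k => NormedSpace.exp (x • serviceGenerator m N μ) i k)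
    (fun j _ => exp_serviceGenerator_nonneg hμ hx i j) (Finset.mem_univ k)

theorem continuous_exp_serviceGenerator (i k : Fin (N + 1)) :
    Continuous fun x : ℝ => NormedSpace.exp (x • serviceGenerator m N μ) i k := by
  refine continuous_iff_continuousAt.2 fun x => ?_
  simpa using
    (hasDerivAt_exp_smul_mulVec (serviceGenerator m N μ) (Pi.single k 1) x i).continuousAt

/-- During a period of positive length all customers may leave the system. -/
theorem exp_serviceGenerator_zero_pos (hm : 1 ≤ m) (hμ : 0 < μ) {x : ℝ} (hx : 0 < x)
    (i : Fin (N + 1)) :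
    0 < NormedSpace.exp (x • serviceGenerator m N μ) i 0 := by
  have hs : ∀ (y : ℝ) (i : Fin (N + 1)), NormedSpace.exp (y • serviceGenerator m N μ) i 0 =
      (NormedSpace.exp (y • serviceGenerator m N μ) *ᵥ (Pi.single 0 1)) i := by simp
  simp only [hs]
  obtain ⟨j, hj⟩ := i
  induction j generalizing x with
  | zero =>
    have hd : ∀ y, HasDerivAt (fun y : ℝ =>
        (NormedSpace.exp (y • serviceGenerator m N μ) *ᵥ Pi.single 0 1) 0) 0 y := by
      intro y
      have := hasDerivAt_exp_smul_mulVec (serviceGenerator m N μ) (Pi.single 0 1) y 0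
      rwa [serviceGenerator_mulVec_zero] at this
    have := is_const_of_deriv_eq_zero (fun y => (hd y).differentiableAt)
      (fun y => (hd y).deriv) x 0
    have h2 : (NormedSpace.exp (x • serviceGenerator m N μ) *ᵥ Pi.single 0 1) 0 = 1 := by
      rw [this]; simp
    exact h2.symm.le.trans_lt' one_pos
  | succ j ih =>
    refine pos_of_hasDerivAt_linear (q := μ * (min (j + 1) m : ℕ))
      (g := fun x : ℝ => (NormedSpace.exp (x • serviceGenerator m N μ) *ᵥ
        (Pi.single 0 1)) ⟨j + 1, hj⟩)
      (φ := fun x : ℝ => (NormedSpace.exp (x • serviceGenerator m N μ) *ᵥ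
        (Pi.single 0 1)) ⟨j, by omega⟩)
      ?_ (fun y => ?_) (by simp) (fun y hy => ih hy _) hx
    · have : 0 < min (j + 1) m := by omega
      positivity
    · have := hasDerivAt_exp_smul_mulVec (serviceGenerator m N μ) (Pi.single 0 1) y ⟨j + 1, hj⟩
      rwa [serviceGenerator_mulVec_succ] at this

end Semigroup

/-! ### Stationary laws of finite stochastic matrices -/

section Stochastic

variable {ι : Type*} [Fintype ι] {P : Matrix ι ι ℝ}

/-- The entrywise absolute value of a left fixed vector of a stochastic matrix is again fixed:
the inequality `|v| ≤ |v| P` holds entrywise, and both sides have the same sum. -/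
theorem abs_vecMul_eq_of_vecMul_eq (h0 : ∀ i k, 0 ≤ P i k) (h1 : ∀ i, ∑ k, P i k = 1)
    {v : ι → ℝ} (hv : v ᵥ* P = v) : |v| ᵥ* P = |v| := by
  have hle : ∀ k ∈ Finset.univ, |v| k ≤ (|v| ᵥ* P) k := by
    intro k _
    calc |v| k = |(v ᵥ* P) k| := by rw [hv]; rfl
      _ ≤ ∑ i, |v i * P i k| := by
        simpa only [Matrix.vecMul, dotProduct] using Finset.abs_sum_le_sum_abs _ _
      _ = (|v| ᵥ* P) k := by
        simp only [Matrix.vecMul, dotProduct, abs_mul, abs_of_nonneg (h0 _ _), Pi.abs_apply]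
  have hsum : ∑ k, |v| k = ∑ k, (|v| ᵥ* P) k := by
    simp only [Matrix.vecMul, dotProduct]
    rw [Finset.sum_comm]
    simp [← Finset.mul_sum, h1]
  ext k
  exact ((Finset.sum_eq_sum_iff_of_le hle).1 hsum k (Finset.mem_univ k)).symm

theorem exists_isStationaryLaw [Nonempty ι] (h0 : ∀ i k, 0 ≤ P i k) (h1 : ∀ i, ∑ k, P i k = 1) :
    ∃ w, IsStationaryLaw P w := by
  classical
  have hdet : (P - 1).det = 0 := by
    refine Matrix.exists_mulVec_eq_zero_iff.1 ⟨fun _ => 1, ?_, ?_⟩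
    · intro h
      exact one_ne_zero (congrFun h (Classical.arbitrary ι))
    · rw [Matrix.sub_mulVec, Matrix.one_mulVec]
      ext i
      simp [Matrix.mulVec, dotProduct, h1]
  obtain ⟨v, hv0, hv⟩ := Matrix.exists_vecMul_eq_zero_iff.2 hdet
  rw [Matrix.vecMul_sub, Matrix.vecMul_one, sub_eq_zero] at hv
  have habs := abs_vecMul_eq_of_vecMul_eq h0 h1 hv
  have hpos : 0 < ∑ k, |v| k := by
    obtain ⟨k, hk⟩ := Function.ne_iff.1 hv0
    exact Finset.sum_pos' (fun i _ => abs_nonneg (v i)) ⟨k, Finset.mem_univ k, abs_pos.2 hk⟩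
  refine ⟨(∑ k, |v| k)⁻¹ • |v|, ⟨fun i => ?_, ?_⟩, ?_⟩
  · exact mul_nonneg (inv_nonneg.2 hpos.le) (abs_nonneg (v i))
  · simp only [Pi.smul_apply, smul_eq_mul, ← Finset.mul_sum]
    exact inv_mul_cancel₀ hpos.ne'
  · rw [Matrix.smul_vecMul, habs]

/-- If some state can be reached from everywhere in one step, then the stationary law is unique:
the positive and the negative part of the difference of two stationary laws are both fixed, hence
both charge that state unless they vanish. -/
theorem existsUnique_isStationaryLaw (h0 : ∀ i k, 0 ≤ P i k) (h1 : ∀ i, ∑ k, P i k = 1) (o : ι)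
    (ho : ∀ i, 0 < P i o) : ∃! w, IsStationaryLaw P w := by
  have : Nonempty ι := ⟨o⟩
  obtain ⟨w, hw⟩ := exists_isStationaryLaw h0 h1
  refine ⟨w, hw, fun w' hw' => ?_⟩
  set d := w' - w with hd
  have hdP : d ᵥ* P = d := by rw [hd, Matrix.sub_vecMul, hw.2, hw'.2]
  have habs := abs_vecMul_eq_of_vecMul_eq h0 h1 hdP
  have hds : ∑ k, d k = 0 := by simp [hd, hw.1.2, hw'.1.2]
  have key : ∀ e : ι → ℝ, (∀ i, 0 ≤ e i) → e ᵥ* P = e → e o ≤ 0 → ∀ i, e i = 0 := by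
    intro e he heP heo i
    have h : ∑ i, e i * P i o ≤ 0 := by
      calc ∑ i, e i * P i o = (e ᵥ* P) o := rfl
        _ ≤ 0 := by rw [heP]; exact heo
    have h' := (Finset.sum_eq_zero_iff_of_nonneg
      (fun i _ => mul_nonneg (he i) (h0 i o))).1
      (le_antisymm h (Finset.sum_nonneg fun i _ => mul_nonneg (he i) (h0 i o))) i
      (Finset.mem_univ i)
    exact (mul_eq_zero.1 h').resolve_right (ho i).ne'
  have hd0 : d = 0 := by
    rcases le_total (d o) 0 with h | h
    · have := key (|d| + d) (fun i => by
        have := neg_abs_le (d i); simp only [Pi.add_apply, Pi.abs_apply]; linarith)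
        (by rw [Matrix.add_vecMul, habs, hdP]) (by simp [abs_of_nonpos h])
      have hneg : ∀ i ∈ Finset.univ, d i ≤ 0 := fun i _ => by
        have h2 := this i
        simp only [Pi.add_apply, Pi.abs_apply] at h2
        linarith [abs_nonneg (d i)]
      ext i
      exact (Finset.sum_eq_zero_iff_of_nonpos hneg).1 hds i (Finset.mem_univ i)
    · have := key (|d| - d) (fun i => by
        have := le_abs_self (d i); simp only [Pi.sub_apply, Pi.abs_apply]; linarith)
        (by rw [Matrix.sub_vecMul, habs, hdP]) (by simp [abs_of_nonneg h])
      have hneg : ∀ i ∈ Finset.univ, 0 ≤ d i := fun i _ => by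
        have h2 := this i
        simp only [Pi.sub_apply, Pi.abs_apply] at h2
        linarith [abs_nonneg (d i)]
      ext i
      exact (Finset.sum_eq_zero_iff_of_nonneg hneg).1 hds i (Finset.mem_univ i)
  exact sub_eq_zero.1 hd0

end Stochastic

/-! ### The embedded chain -/

section Chain

variable {m n : ℕ} {μ : ℝ} {A : Measure ℝ}

theorem IsInterarrivalLaw.ae_nonneg (hA : IsInterarrivalLaw A) : ∀ᵐ x ∂A, 0 ≤ x := by
  rw [ae_iff]
  simpa [Set.Iio_def] using hA.nonneg

theorem integrable_exp_serviceGenerator (hA : IsInterarrivalLaw A) (hμ : 0 ≤ μ) {N : ℕ}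
    (i k : Fin (N + 1)) :
    Integrable (fun x : ℝ => NormedSpace.exp (x • serviceGenerator m N μ) i k) A := by
  have := hA.isProbabilityMeasure
  refine (integrable_const (1 : ℝ)).mono'
    (continuous_exp_serviceGenerator i k).aestronglyMeasurable ?_
  filter_upwards [hA.ae_nonneg] with x hx
  rw [Real.norm_eq_abs, abs_of_nonneg (exp_serviceGenerator_nonneg hμ hx i k)]
  exact exp_serviceGenerator_le_one hμ hx i k

theorem transitionMatrix_nonneg (hA : IsInterarrivalLaw A) (hμ : 0 ≤ μ) (i k : Fin (m + n + 1)) :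
    0 ≤ transitionMatrix m n μ A i k := by
  refine integral_nonneg_of_ae ?_
  filter_upwards [hA.ae_nonneg] with x hx
  exact exp_serviceGenerator_nonneg hμ hx _ k

theorem sum_transitionMatrix (hA : IsInterarrivalLaw A) (hμ : 0 ≤ μ) (i : Fin (m + n + 1)) :
    ∑ k, transitionMatrix m n μ A i k = 1 := by
  have := hA.isProbabilityMeasure
  simp only [transitionMatrix]
  rw [← integral_finsetSum _ fun k _ => integrable_exp_serviceGenerator hA hμ _ k]
  simp [sum_exp_serviceGenerator]

theorem transitionMatrix_zero_pos (hm : 1 ≤ m) (hA : IsInterarrivalLaw A) (hμ : 0 < μ)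
    (i : Fin (m + n + 1)) : 0 < transitionMatrix m n μ A i 0 := by
  refine (transitionMatrix_nonneg hA hμ.le i 0).lt_of_ne' fun h => ?_
  have hae := (integral_eq_zero_iff_of_nonneg_ae (by
    filter_upwards [hA.ae_nonneg] with x hx
    exact exp_serviceGenerator_nonneg hμ.le hx _ 0)
    (integrable_exp_serviceGenerator hA hμ.le (afterArrival (m + n) i) 0)).1 h
  have h0 : (fun x : ℝ => x) =ᵐ[A] 0 := by
    filter_upwards [hA.ae_nonneg, hae] with x hx hx'
    by_contra hne
    exact (exp_serviceGenerator_zero_pos hm hμ (lt_of_le_of_ne hx (Ne.symm hne)) _).ne' hx'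
  have := hA.mean_pos
  rw [integral_congr_ae h0] at this
  simp at this

theorem existsUnique_isStationaryLaw_transitionMatrix (hm : 1 ≤ m) (hA : IsInterarrivalLaw A)
    (hμ : 0 < μ) : ∃! w, IsStationaryLaw (transitionMatrix m n μ A) w :=
  existsUnique_isStationaryLaw (transitionMatrix_nonneg hA hμ.le) (sum_transitionMatrix hA hμ.le) 0
    (transitionMatrix_zero_pos hm hA hμ)

theorem exists_isStationaryLaw_lossProb (hm : 1 ≤ m) (hA : IsInterarrivalLaw A) (hμ : 0 < μ) :
    ∃ w, IsStationaryLaw (transitionMatrix m n μ A) w ∧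
      w (Fin.last (m + n)) = lossProb m n μ A :=
  ⟨_, Classical.epsilon_spec (existsUnique_isStationaryLaw_transitionMatrix hm hA hμ).exists, rfl⟩

/-- The expected value of `f` at the number of customers present a time `x` after an arrival that
finds a number of customers with law `w`, no further customer having arrived. -/
noncomputable def meanAfter (m N : ℕ) (μ : ℝ) (w f : Fin (N + 1) → ℝ) (x : ℝ) : ℝ :=
  ∑ i, w i * (NormedSpace.exp (x • serviceGenerator m N μ) *ᵥ f) (afterArrival N i)

variable {N : ℕ} {w f g : Fin (N + 1) → ℝ}

theorem hasDerivAt_meanAfter (x : ℝ) :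
    HasDerivAt (meanAfter m N μ w f) (meanAfter m N μ w (serviceGenerator m N μ *ᵥ f) x) x :=
  HasDerivAt.fun_sum fun i _ =>
    (hasDerivAt_exp_smul_mulVec' (serviceGenerator m N μ) f x (afterArrival N i)).const_mul (w i)

theorem meanAfter_zero : meanAfter m N μ w f 0 = ∑ i, w i * f (afterArrival N i) := by
  simp [meanAfter]

theorem meanAfter_add (x : ℝ) :
    meanAfter m N μ w (f + g) x = meanAfter m N μ w f x + meanAfter m N μ w g x := by
  simp [meanAfter, Matrix.mulVec_add, mul_add, Finset.sum_add_distrib]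

theorem meanAfter_smul (c x : ℝ) :
    meanAfter m N μ w (c • f) x = c * meanAfter m N μ w f x := by
  simp [meanAfter, Matrix.mulVec_smul, Finset.mul_sum, mul_left_comm]

theorem meanAfter_mono (hμ : 0 ≤ μ) (hw : ∀ i, 0 ≤ w i) (hfg : ∀ j, f j ≤ g j) {x : ℝ}
    (hx : 0 ≤ x) : meanAfter m N μ w f x ≤ meanAfter m N μ w g x :=
  Finset.sum_le_sum fun i _ =>
    mul_le_mul_of_nonneg_left (exp_serviceGenerator_mulVec_mono hμ hfg hx _) (hw i)

theorem meanAfter_const (hw : ∑ i, w i = 1) (c x : ℝ) :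
    meanAfter m N μ w (fun _ => c) x = c := by
  simp [meanAfter, exp_serviceGenerator_mulVec_const, ← Finset.sum_mul, hw]

theorem integrable_meanAfter (hA : IsInterarrivalLaw A) (hμ : 0 ≤ μ) :
    Integrable (meanAfter m N μ w f) A := by
  refine integrable_finsetSum _ fun i _ => Integrable.const_mul ?_ (w i)
  simp only [Matrix.mulVec, dotProduct]
  exact integrable_finsetSum _ fun k _ =>
    (integrable_exp_serviceGenerator hA hμ (afterArrival N i) k).mul_const (f k)

/-- Stationarity, tested against a function: just before the next arrival its mean is the same. -/
theorem IsStationaryLaw.integral_meanAfter {w f : Fin (m + n + 1) → ℝ}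
    (hA : IsInterarrivalLaw A) (hμ : 0 ≤ μ)
    (hw : IsStationaryLaw (transitionMatrix m n μ A) w) :
    ∫ x, meanAfter m (m + n) μ w f x ∂A = ∑ i, w i * f i := by
  have hint : ∀ i k, Integrable (fun x : ℝ => NormedSpace.exp
      (x • serviceGenerator m (m + n) μ) (afterArrival (m + n) i) k * f k) A := fun i k =>
    (integrable_exp_serviceGenerator hA hμ _ k).mul_const (f k)
  simp only [meanAfter, Matrix.mulVec, dotProduct]
  rw [integral_finsetSum _ fun i _ => (integrable_finsetSum _ fun k _ => hint i k).const_mul (w i)]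
  calc _ = ∑ i, w i * ∑ k, transitionMatrix m n μ A i k * f k := by
        refine Finset.sum_congr rfl fun i _ => ?_
        rw [integral_const_mul, integral_finsetSum _ fun k _ => hint i k]
        simp only [integral_mul_const, transitionMatrix]
    _ = ∑ k, (w ᵥ* transitionMatrix m n μ A) k * f k := by
        simp only [Matrix.vecMul, dotProduct, Finset.mul_sum, Finset.sum_mul]
        rw [Finset.sum_comm]
        simp only [mul_assoc]
    _ = _ := by rw [hw.2]

/-- Admitting the arriving customer, unless the system is full, shifts the law by one place. -/
theorem sum_mul_afterArrival (w : Fin (N + 1) → ℝ) (φ : ℕ → ℝ) :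
    ∑ i, w i * φ (afterArrival N i) =
      ∑ i, w i * φ (i + 1) - w (Fin.last N) * (φ (N + 1) - φ N) := by
  rw [Fin.sum_univ_castSucc, Fin.sum_univ_castSucc (f := fun i => w i * φ (i + 1))]
  have h1 : ((afterArrival N (Fin.last N) : Fin (N + 1)) : ℕ) = N := by simp [afterArrival]
  have h2 : ∀ i : Fin N, ((afterArrival N i.castSucc : Fin (N + 1)) : ℕ) = i + 1 := fun i => by
    have := i.2
    simp only [afterArrival, Fin.val_castSucc]
    omega
  simp only [h1, h2, Fin.val_castSucc, Fin.val_last]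
  ring

end Chain

/-! ### Idle capacity and two test functions -/

section TestFunctions

variable {m N : ℕ} {μ : ℝ} {w : Fin (N + 1) → ℝ}

/-- The rate at which service capacity is left unused, as a function of the number of customers. -/
def idleRate (m N : ℕ) (μ : ℝ) (j : Fin (N + 1)) : ℝ := μ * (m - (min (j : ℕ) m : ℕ))

theorem idleRate_nonneg (hμ : 0 ≤ μ) (j : Fin (N + 1)) : 0 ≤ idleRate m N μ j := by
  refine mul_nonneg hμ (sub_nonneg.2 ?_)
  exact_mod_cast min_le_right _ _

theorem idleRate_le (hμ : 0 ≤ μ) (j : Fin (N + 1)) : idleRate m N μ j ≤ μ * m := by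
  refine mul_le_mul_of_nonneg_left ?_ hμ
  have : (0 : ℝ) ≤ (min (j : ℕ) m : ℕ) := Nat.cast_nonneg _
  linarith

/-- The expected capacity left unused in the time `x` after an arrival that finds a number of
customers with law `w`: the integral of `meanAfter m N μ w (idleRate m N μ)` over `[0, x]`, written
without an integral by means of the expected number of departures. -/
noncomputable def idleMean (m N : ℕ) (μ : ℝ) (w : Fin (N + 1) → ℝ) (x : ℝ) : ℝ :=
  meanAfter m N μ w (fun j => (j : ℝ)) x - meanAfter m N μ w (fun j => (j : ℝ)) 0 + μ * m * x

theorem serviceGenerator_mulVec_natCast :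
    serviceGenerator m N μ *ᵥ (fun j => ((j : ℕ) : ℝ)) =
      idleRate m N μ + fun _ => -(μ * m) := by
  ext ⟨j, hj⟩
  cases j with
  | zero =>
    refine (serviceGenerator_mulVec_zero m N μ _).trans ?_
    simp [idleRate]
  | succ j =>
    rw [serviceGenerator_mulVec_succ]
    simp only [idleRate, Pi.add_apply]
    push_cast
    ring

/-- The geometric function `j ↦ z ^ j` with `z = (1 - u)⁻¹` is an eigenvector of the generator, up
to a term that is carried by the states with idle servers. -/
theorem serviceGenerator_mulVec_pow {u z : ℝ} (hz : z * (1 - u) = 1) :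
    serviceGenerator m N μ *ᵥ (fun j => z ^ (j : ℕ)) =
      (-(u * (μ * m))) • (fun j : Fin (N + 1) => z ^ (j : ℕ)) +
        u • (fun j => idleRate m N μ j * z ^ (j : ℕ)) := by
  ext ⟨j, hj⟩
  cases j with
  | zero =>
    refine (serviceGenerator_mulVec_zero m N μ _).trans ?_
    simp [idleRate]
  | succ j =>
    rw [serviceGenerator_mulVec_succ]
    simp only [idleRate, Pi.add_apply, Pi.smul_apply, smul_eq_mul, pow_succ]
    have : z ^ j = z ^ j * z * (1 - u) := by rw [mul_assoc, hz, mul_one]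
    rw [show z ^ j - z ^ j * z = -(z ^ j * z * u) by linarith]
    ring

theorem hasDerivAt_idleMean (hw : ∑ i, w i = 1) (x : ℝ) :
    HasDerivAt (idleMean m N μ w) (meanAfter m N μ w (idleRate m N μ) x) x := by
  have h := ((hasDerivAt_meanAfter (m := m) (μ := μ) (w := w)
    (f := fun j => ((j : ℕ) : ℝ)) x).sub_const
      (meanAfter m N μ w (fun j => ((j : ℕ) : ℝ)) 0)).add ((hasDerivAt_id x).const_mul (μ * m))
  rw [serviceGenerator_mulVec_natCast, meanAfter_add, meanAfter_const hw] at h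
  exact h.congr_deriv (by ring)

theorem idleMean_zero : idleMean m N μ w 0 = 0 := by simp [idleMean]

theorem meanAfter_idleRate_nonneg (hμ : 0 ≤ μ) (hw : w ∈ stdSimplex ℝ (Fin (N + 1))) {x : ℝ}
    (hx : 0 ≤ x) : 0 ≤ meanAfter m N μ w (idleRate m N μ) x := by
  have := meanAfter_mono (m := m) hμ hw.1 (f := fun _ => 0) (idleRate_nonneg (m := m) hμ) hx
  rwa [meanAfter_const hw.2] at this

theorem meanAfter_idleRate_le (hμ : 0 ≤ μ) (hw : w ∈ stdSimplex ℝ (Fin (N + 1))) {x : ℝ}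
    (hx : 0 ≤ x) : meanAfter m N μ w (idleRate m N μ) x ≤ μ * m := by
  have := meanAfter_mono (m := m) hμ hw.1 (g := fun _ => μ * m) (idleRate_le hμ) hx
  rwa [meanAfter_const hw.2] at this

/-- A differentiable function with nonnegative derivative on `[0, ∞)` is at least its initial
value. -/
theorem le_of_hasDerivAt_nonneg {F F' : ℝ → ℝ} (hF : ∀ x, HasDerivAt F (F' x) x)
    (h : ∀ x, 0 ≤ x → 0 ≤ F' x) {x : ℝ} (hx : 0 ≤ x) : F 0 ≤ F x := by
  refine monotoneOn_of_deriv_nonneg (convex_Ici 0)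
    (fun y _ => (hF y).continuousAt.continuousWithinAt)
    (fun y _ => (hF y).differentiableAt.differentiableWithinAt) (fun y hy => ?_)
    Set.self_mem_Ici (Set.mem_Ici.2 hx) hx
  rw [interior_Ici, Set.mem_Ioi] at hy
  rw [(hF y).deriv]
  exact h y hy.le

theorem idleMean_nonneg (hμ : 0 ≤ μ) (hw : w ∈ stdSimplex ℝ (Fin (N + 1))) {x : ℝ}
    (hx : 0 ≤ x) : 0 ≤ idleMean m N μ w x := by
  simpa [idleMean_zero] using le_of_hasDerivAt_nonneg (hasDerivAt_idleMean (m := m) (μ := μ) hw.2)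
    (fun y hy => meanAfter_idleRate_nonneg hμ hw hy) hx

theorem idleMean_le (hμ : 0 ≤ μ) (hw : w ∈ stdSimplex ℝ (Fin (N + 1))) {x : ℝ}
    (hx : 0 ≤ x) : idleMean m N μ w x ≤ μ * m * x := by
  have := le_of_hasDerivAt_nonneg (F := fun x => μ * m * x - idleMean m N μ w x)
    (fun y => ((hasDerivAt_id y).const_mul (μ * m)).sub
      (hasDerivAt_idleMean (m := m) (μ := μ) hw.2 y))
    (fun y hy => by simpa using meanAfter_idleRate_le (m := m) hμ hw hy) hx
  simp only [idleMean_zero, mul_zero, sub_zero] at this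
  linarith

variable {u z : ℝ}

theorem hasDerivAt_exp_mul_meanAfter_pow (hz : z * (1 - u) = 1) (x : ℝ) :
    HasDerivAt (fun x => Real.exp (u * (μ * m * x)) * meanAfter m N μ w (fun j => z ^ (j : ℕ)) x)
      (u * Real.exp (u * (μ * m * x)) *
        meanAfter m N μ w (fun j => idleRate m N μ j * z ^ (j : ℕ)) x) x := by
  have h1 : HasDerivAt (fun y : ℝ => Real.exp (u * (μ * m * y)))
      (Real.exp (u * (μ * m * x)) * (u * (μ * m * 1))) x :=
    (((hasDerivAt_id x).const_mul (μ * m)).const_mul u).exp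
  have h2 := hasDerivAt_meanAfter (m := m) (μ := μ) (w := w) (f := fun j => z ^ (j : ℕ)) x
  rw [serviceGenerator_mulVec_pow hz, meanAfter_add, meanAfter_smul, meanAfter_smul] at h2
  exact (h1.mul h2).congr_deriv (by ring)

theorem one_le_of_mul_one_sub (hu : 0 ≤ u) (hu1 : u < 1) (hz : z * (1 - u) = 1) : 1 ≤ z := by
  by_contra! h
  nlinarith

/-- Lower half of the variation-of-constants formula for the mean of `z ^ j`: the source term
`idleRate j * z ^ j` is bounded below by `idleRate j`. -/
theorem le_meanAfter_pow (hμ : 0 ≤ μ) (hw : w ∈ stdSimplex ℝ (Fin (N + 1))) (hu : 0 ≤ u)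
    (hu1 : u < 1) (hz : z * (1 - u) = 1) {x : ℝ} (hx : 0 ≤ x) :
    Real.exp (-(u * (μ * m * x))) *
        (meanAfter m N μ w (fun j => z ^ (j : ℕ)) 0 + u * idleMean m N μ w x) ≤
      meanAfter m N μ w (fun j => z ^ (j : ℕ)) x := by
  have hz1 := one_le_of_mul_one_sub hu hu1 hz
  have := le_of_hasDerivAt_nonneg (fun y => (hasDerivAt_exp_mul_meanAfter_pow (m := m) (N := N)
    (μ := μ) (w := w) hz y).sub ((hasDerivAt_idleMean (m := m) (μ := μ) hw.2 y).const_mul u))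
    (fun y hy => by
      have h1 : meanAfter m N μ w (idleRate m N μ) y ≤
          meanAfter m N μ w (fun j => idleRate m N μ j * z ^ (j : ℕ)) y :=
        meanAfter_mono hμ hw.1 (fun j => le_mul_of_one_le_right (idleRate_nonneg hμ j)
          (one_le_pow₀ hz1)) hy
      have h2 := meanAfter_idleRate_nonneg (m := m) hμ hw hy
      have h3 : 1 ≤ Real.exp (u * (μ * m * y)) := Real.one_le_exp (by positivity)
      have h4 : meanAfter m N μ w (idleRate m N μ) y ≤ Real.exp (u * (μ * m * y)) *
          meanAfter m N μ w (fun j => idleRate m N μ j * z ^ (j : ℕ)) y :=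
        h1.trans (le_mul_of_one_le_left (h2.trans h1) h3)
      have := mul_le_mul_of_nonneg_left h4 hu
      linarith) hx
  simp only [Pi.sub_apply, mul_zero, Real.exp_zero, one_mul, idleMean_zero, sub_zero] at this
  rw [Real.exp_neg, inv_mul_le_iff₀ (Real.exp_pos _)]
  linarith

/-- Upper half of the variation-of-constants formula for the mean of `z ^ j`: the source term
`idleRate j * z ^ j` vanishes for `j ≥ m`, hence is at most `z ^ m * idleRate j`. -/
theorem meanAfter_pow_le (hμ : 0 ≤ μ) (hw : w ∈ stdSimplex ℝ (Fin (N + 1)))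
    (hu : 0 ≤ u) (hu1 : u < 1) (hz : z * (1 - u) = 1) {x : ℝ} (hx : 0 ≤ x) :
    meanAfter m N μ w (fun j => z ^ (j : ℕ)) x ≤
      Real.exp (-(u * (μ * m * x))) * meanAfter m N μ w (fun j => z ^ (j : ℕ)) 0 +
        u * z ^ m * idleMean m N μ w x := by
  have hz1 := one_le_of_mul_one_sub hu hu1 hz
  have hE : ∀ y : ℝ, HasDerivAt (fun y : ℝ => Real.exp (u * (μ * m * y)))
      (Real.exp (u * (μ * m * y)) * (u * (μ * m * 1))) y := fun y =>
    (((hasDerivAt_id y).const_mul (μ * m)).const_mul u).exp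
  have := le_of_hasDerivAt_nonneg (fun y => (((hE y).mul
    (hasDerivAt_idleMean (m := m) (μ := μ) hw.2 y)).const_mul (u * z ^ m)).sub
      (hasDerivAt_exp_mul_meanAfter_pow (m := m) (N := N) (μ := μ) (w := w) hz y))
    (fun y hy => by
      have h1 : meanAfter m N μ w (fun j => idleRate m N μ j * z ^ (j : ℕ)) y ≤
          z ^ m * meanAfter m N μ w (idleRate m N μ) y := by
        rw [← meanAfter_smul]
        refine meanAfter_mono hμ hw.1 (fun j => ?_) hy
        simp only [Pi.smul_apply, smul_eq_mul]
        rcases le_total (j : ℕ) m with h | h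
        · rw [mul_comm]
          exact mul_le_mul_of_nonneg_right (pow_le_pow_right₀ hz1 h) (idleRate_nonneg hμ j)
        · simp [idleRate, h]
      have h2 := idleMean_nonneg (m := m) hμ hw hy
      have h3 : 0 ≤ u * Real.exp (u * (μ * m * y)) := by positivity
      have h4 : 0 ≤ u * z ^ m * (Real.exp (u * (μ * m * y)) * (u * (μ * m * 1)) *
        idleMean m N μ w y) := by positivity
      have := mul_le_mul_of_nonneg_left h1 h3
      linarith) hx
  simp only [Pi.sub_apply, Pi.mul_apply, mul_zero, Real.exp_zero, one_mul, idleMean_zero,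
    zero_sub] at this
  have hp := Real.exp_pos (u * (μ * m * x))
  rw [Real.exp_neg, ← sub_le_iff_le_add, ← div_eq_inv_mul, le_div_iff₀ hp]
  linarith

end TestFunctions

/-! ### The loss balance -/

section Balance

theorem exp_neg_le_quadratic {y : ℝ} (hy : 0 ≤ y) : Real.exp (-y) ≤ 1 - y + y ^ 2 / 2 := by
  have hd : ∀ x : ℝ, HasDerivAt (fun x : ℝ => 1 - x + x ^ 2 / 2 - Real.exp (-x))
      (-1 + x + Real.exp (-x)) x := fun x =>
    ((((hasDerivAt_id x).const_sub 1).add ((hasDerivAt_pow 2 x).div_const 2)).sub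
      (hasDerivAt_id x).neg.exp).congr_deriv (by simp)
  have := le_of_hasDerivAt_nonneg hd (fun x _ => by linarith [Real.add_one_le_exp (-x)]) hy
  norm_num at this
  linarith

theorem cubic_le_exp_neg {y : ℝ} (hy : 0 ≤ y) :
    1 - y + y ^ 2 / 2 - y ^ 3 / 6 ≤ Real.exp (-y) := by
  have hd : ∀ x : ℝ, HasDerivAt (fun x : ℝ => Real.exp (-x) - (1 - x + x ^ 2 / 2 - x ^ 3 / 6))
      (1 - x + x ^ 2 / 2 - Real.exp (-x)) x := fun x =>
    ((hasDerivAt_id x).neg.exp.sub ((((hasDerivAt_id x).const_sub 1).add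
      ((hasDerivAt_pow 2 x).div_const 2)).sub ((hasDerivAt_pow 3 x).div_const 6))).congr_deriv
      (by simp; ring)
  have := le_of_hasDerivAt_nonneg hd (fun x hx => by linarith [exp_neg_le_quadratic hx]) hy
  norm_num at this
  linarith

variable {m n : ℕ} {μ : ℝ} {A : Measure ℝ}

theorem IsInterarrivalLaw.integrable_sq (hA : IsInterarrivalLaw A)
    (h3 : Integrable (fun x : ℝ => x ^ 3) A) : Integrable (fun x : ℝ => x ^ 2) A := by
  have := hA.isProbabilityMeasure
  refine ((integrable_const (1 : ℝ)).add h3).mono' (by fun_prop) ?_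
  filter_upwards [hA.ae_nonneg] with x hx
  rw [Real.norm_eq_abs, abs_of_nonneg (by positivity)]
  simp only [Pi.add_apply]
  nlinarith [mul_nonneg hx (sq_nonneg (x - 1)), sq_nonneg (x - 1)]

theorem integrable_normalized_pow {k : ℕ} (h : Integrable (fun x : ℝ => x ^ k) A) :
    Integrable (fun x : ℝ => (μ * m * x) ^ k) A := by
  simp only [mul_pow (μ * m)]
  exact h.const_mul _

theorem integrable_exp_neg_mul (hA : IsInterarrivalLaw A) (hμ : 0 ≤ μ) {u : ℝ} (hu : 0 ≤ u) :
    Integrable (fun x : ℝ => Real.exp (-(u * (μ * m * x)))) A := by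
  have := hA.isProbabilityMeasure
  refine (integrable_const (1 : ℝ)).mono' (by fun_prop) ?_
  filter_upwards [hA.ae_nonneg] with x hx
  rw [Real.norm_eq_abs, abs_of_pos (Real.exp_pos _)]
  exact Real.exp_le_one_iff.2 (by simp only [Left.neg_nonpos_iff]; positivity)

/-- The Laplace transform of the interarrival law to third order. -/
theorem laplace_bounds (hA : IsInterarrivalLaw A) (hμ : 0 ≤ μ)
    (h3 : Integrable (fun x : ℝ => x ^ 3) A) {u : ℝ} (hu : 0 ≤ u) :
    1 - u * (μ * m * ∫ x, x ∂A) + u ^ 2 * normalizedMoment 2 m μ A / 2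
        - u ^ 3 * normalizedMoment 3 m μ A / 6 ≤ ∫ x, Real.exp (-(u * (μ * m * x))) ∂A ∧
    ∫ x, Real.exp (-(u * (μ * m * x))) ∂A ≤
      1 - u * (μ * m * ∫ x, x ∂A) + u ^ 2 * normalizedMoment 2 m μ A / 2 := by
  have := hA.isProbabilityMeasure
  have i1 : Integrable (fun x : ℝ => u * (μ * m * x)) A := (hA.integrable.const_mul _).const_mul _
  have i2 : Integrable (fun x : ℝ => u ^ 2 * (μ * m * x) ^ 2 / 2) A :=
    ((integrable_normalized_pow (hA.integrable_sq h3)).const_mul _).div_const _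
  have i3 : Integrable (fun x : ℝ => u ^ 3 * (μ * m * x) ^ 3 / 6) A :=
    ((integrable_normalized_pow h3).const_mul _).div_const _
  have i0 := integrable_const (μ := A) (1 : ℝ)
  have i01 : Integrable (fun x : ℝ => 1 - u * (μ * m * x)) A := i0.sub i1
  have i012 : Integrable (fun x : ℝ => 1 - u * (μ * m * x) + u ^ 2 * (μ * m * x) ^ 2 / 2) A :=
    i01.add i2
  have e2 : ∫ x, (1 - u * (μ * m * x) + u ^ 2 * (μ * m * x) ^ 2 / 2) ∂A =
      1 - u * (μ * m * ∫ x, x ∂A) + u ^ 2 * normalizedMoment 2 m μ A / 2 := by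
    rw [integral_add i01 i2, integral_sub i0 i1, integral_div, integral_const_mul,
      integral_const_mul, integral_const_mul]
    simp [normalizedMoment]
  constructor
  · rw [← e2]
    have e3 : ∫ x, u ^ 3 * (μ * m * x) ^ 3 / 6 ∂A = u ^ 3 * normalizedMoment 3 m μ A / 6 := by
      rw [integral_div, integral_const_mul]; rfl
    rw [← e3, ← integral_sub i012 i3]
    refine integral_mono_ae (i012.sub i3) (integrable_exp_neg_mul hA hμ hu) ?_
    filter_upwards [hA.ae_nonneg] with x hx
    have := cubic_le_exp_neg (y := u * (μ * m * x)) (by positivity)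
    linear_combination this
  · rw [← e2]
    refine integral_mono_ae (integrable_exp_neg_mul hA hμ hu) i012 ?_
    filter_upwards [hA.ae_nonneg] with x hx
    have := exp_neg_le_quadratic (y := u * (μ * m * x)) (by positivity)
    linear_combination this

theorem integrable_idleMean (hA : IsInterarrivalLaw A) (hμ : 0 ≤ μ) {N : ℕ}
    {w : Fin (N + 1) → ℝ} : Integrable (idleMean m N μ w) A := by
  have := hA.isProbabilityMeasure
  exact ((integrable_meanAfter hA hμ).sub (integrable_const _)).add (hA.integrable.const_mul _)

/-- Rate conservation: what is served is what is admitted, so the capacity that stays unused during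
an interarrival time is the excess of the capacity over one customer, plus the loss. -/
theorem integral_idleMean (hA : IsInterarrivalLaw A) (hμ : 0 ≤ μ) {w : Fin (m + n + 1) → ℝ}
    (hw : IsStationaryLaw (transitionMatrix m n μ A) w) :
    ∫ x, idleMean m (m + n) μ w x ∂A = μ * m * (∫ x, x ∂A) - 1 + w (Fin.last (m + n)) := by
  have := hA.isProbabilityMeasure
  have h0 := sum_mul_afterArrival w (fun j => (j : ℝ))
  have h1 := hw.1.2
  have i1 : Integrable (fun x => meanAfter m (m + n) μ w (fun j => ((j : ℕ) : ℝ)) x -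
      meanAfter m (m + n) μ w (fun j => ((j : ℕ) : ℝ)) 0) A :=
    (integrable_meanAfter hA hμ).sub (integrable_const _)
  simp only [idleMean]
  rw [integral_add i1 (hA.integrable.const_mul _),
    integral_sub (integrable_meanAfter hA hμ) (integrable_const _),
    hw.integral_meanAfter hA hμ, integral_const, integral_const_mul, meanAfter_zero, h0]
  push_cast
  simp only [mul_add, Finset.sum_add_distrib, mul_one, h1, probReal_univ, one_smul]
  ring

/-- Discounting by `exp (-u S)` hardly changes the expected unused capacity: the difference is at
most `u` times the mean of `S` times the unused capacity. The unused capacity is at most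
`S = μ m x`, so beyond the level `K` this product is at most `S ^ 3 / K`. -/
theorem le_integral_exp_mul_idleMean (hA : IsInterarrivalLaw A) (hμ : 0 ≤ μ)
    (h3 : Integrable (fun x : ℝ => x ^ 3) A) {N : ℕ} {w : Fin (N + 1) → ℝ}
    (hw : w ∈ stdSimplex ℝ (Fin (N + 1))) {u K : ℝ} (hu : 0 ≤ u) (hK : 0 < K) :
    (1 - u * K) * ∫ x, idleMean m N μ w x ∂A - u * normalizedMoment 3 m μ A / K ≤
      ∫ x, Real.exp (-(u * (μ * m * x))) * idleMean m N μ w x ∂A := by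
  have hJ := integrable_idleMean (m := m) (N := N) (w := w) hA hμ
  have i3 : Integrable (fun x : ℝ => u * (μ * m * x) ^ 3 / K) A :=
    ((integrable_normalized_pow h3).const_mul _).div_const _
  have e : (1 - u * K) * ∫ x, idleMean m N μ w x ∂A - u * normalizedMoment 3 m μ A / K =
      ∫ x, ((1 - u * K) * idleMean m N μ w x - u * (μ * m * x) ^ 3 / K) ∂A := by
    rw [integral_sub (hJ.const_mul _) i3, integral_const_mul, integral_div, integral_const_mul]
    rfl
  rw [e]
  have hexp : Integrable (fun x => Real.exp (-(u * (μ * m * x))) * idleMean m N μ w x) A := by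
    refine hJ.bdd_mul (c := 1) (by fun_prop) ?_
    filter_upwards [hA.ae_nonneg] with x hx
    rw [Real.norm_eq_abs, abs_of_pos (Real.exp_pos _)]
    exact Real.exp_le_one_iff.2 (by simp only [Left.neg_nonpos_iff]; positivity)
  refine integral_mono_ae ((hJ.const_mul _).sub i3) hexp ?_
  filter_upwards [hA.ae_nonneg] with x hx
  have hS : 0 ≤ μ * m * x := by positivity
  have h0 := idleMean_nonneg (m := m) hμ hw hx
  have h1 := idleMean_le (m := m) hμ hw hx
  have h2 := Real.add_one_le_exp (-(u * (μ * m * x)))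
  generalize idleMean m N μ w x = J at *
  generalize μ * m * x = S at *
  have hSJ : S * J ≤ K * J + S ^ 3 / K := by
    rcases le_total S K with h | h
    · have := mul_le_mul_of_nonneg_right h h0
      have : 0 ≤ S ^ 3 / K := by positivity
      linarith
    · have h4 : S * J ≤ S ^ 3 / K := by
        rw [le_div_iff₀ hK]
        calc S * J * K ≤ S * S * S := by gcongr
          _ = S ^ 3 := by ring
      have : 0 ≤ K * J := by positivity
      linarith
  calc (1 - u * K) * J - u * S ^ 3 / K = J - u * (K * J + S ^ 3 / K) := by ring
    _ ≤ J - u * (S * J) := by gcongr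
    _ = (-(u * S) + 1) * J := by ring
    _ ≤ Real.exp (-(u * S)) * J := by gcongr

/-- The loss balance. Put `δ = μ m E[x] - 1` and `u = 2 δ / ϱ₂`, so that the Laplace transform of
the interarrival time at `u` is `1 - u` up to third order; then `j ↦ (1 - u) ^ (-j)` is nearly
harmonic for the chain away from its boundaries. Stationarity tested against this function says that
`(1 - u) ^ (-N) p` is nearly the unused capacity, which is `δ + p` by rate conservation. -/
theorem abs_loss_balance_le (hm : 1 ≤ m) (hA : IsInterarrivalLaw A) (hμ : 0 < μ)
    (h3 : Integrable (fun x : ℝ => x ^ 3) A) {δ u z K B : ℝ}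
    (hδ : δ = μ * m * (∫ x, x ∂A) - 1) (hδ0 : 0 ≤ δ) (hu : 0 < u) (hu1 : u < 1)
    (huδ : u * normalizedMoment 2 m μ A = 2 * δ) (hz : z * (1 - u) = 1) (hK : 0 < K)
    (hB : normalizedMoment 3 m μ A ≤ B) :
    |z ^ (m + n) * lossProb m n μ A - (δ + lossProb m n μ A)| ≤
      z ^ (m + n + 1) * u ^ 2 * B / 6 +
        (z ^ m - 1 + u * K) * (δ + lossProb m n μ A) + u * B / K := by
  have := hA.isProbabilityMeasure
  obtain ⟨w, hw, hp⟩ := exists_isStationaryLaw_lossProb (n := n) hm hA hμ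
  rw [← hp]
  have hz1 : 1 ≤ z := one_le_of_mul_one_sub hu.le hu1 hz
  have hI := integral_idleMean hA hμ.le hw
  rw [← hδ] at hI
  obtain ⟨hα1, hα2⟩ := laplace_bounds (m := m) hA hμ.le h3 hu.le
  have hexp := le_integral_exp_mul_idleMean (m := m) hA hμ.le h3 hw.1 hu.le hK
  have hp0 : 0 ≤ w (Fin.last (m + n)) := hw.1.1 _
  have hp1 : w (Fin.last (m + n)) ≤ 1 := by
    rw [← hw.1.2]
    exact Finset.single_le_sum (fun i _ => hw.1.1 i) (Finset.mem_univ _)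
  have hR0 : 0 ≤ normalizedMoment 3 m μ A := by
    refine integral_nonneg_of_ae ?_
    filter_upwards [hA.ae_nonneg] with x hx
    simp only [Pi.zero_apply]
    positivity
  have hV0 : meanAfter m (m + n) μ w (fun j => z ^ (j : ℕ)) 0 =
      z * (∑ i, w i * z ^ (i : ℕ)) - w (Fin.last (m + n)) * (z ^ (m + n + 1) - z ^ (m + n)) := by
    rw [meanAfter_zero, sum_mul_afterArrival w (fun j => z ^ j), Finset.mul_sum]
    congr 1
    refine Finset.sum_congr rfl fun i _ => ?_
    ring
  have hH0 : 0 ≤ ∑ i, w i * z ^ (i : ℕ) :=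
    Finset.sum_nonneg fun i _ => mul_nonneg (hw.1.1 i) (by positivity)
  have hH1 : ∑ i, w i * z ^ (i : ℕ) ≤ z ^ (m + n) := by
    calc ∑ i, w i * z ^ (i : ℕ) ≤ ∑ i, w i * z ^ (m + n) :=
          Finset.sum_le_sum fun i _ => mul_le_mul_of_nonneg_left
            (pow_le_pow_right₀ hz1 (Nat.lt_succ_iff.1 i.2)) (hw.1.1 i)
      _ = z ^ (m + n) := by rw [← Finset.sum_mul, hw.1.2, one_mul]
  have iα := integrable_exp_neg_mul (m := m) hA hμ.le hu.le
  have iJ := integrable_idleMean (m := m) (w := w) hA hμ.le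
  have iV := integrable_meanAfter (m := m) (w := w) (f := fun j => z ^ (j : ℕ)) hA hμ.le
  have iαJ : Integrable
      (fun x => Real.exp (-(u * (μ * m * x))) * idleMean m (m + n) μ w x) A := by
    refine iJ.bdd_mul (c := 1) (by fun_prop) ?_
    filter_upwards [hA.ae_nonneg] with x hx
    rw [Real.norm_eq_abs, abs_of_pos (Real.exp_pos _)]
    exact Real.exp_le_one_iff.2 (by simp only [Left.neg_nonpos_iff]; positivity)
  have hup := integral_mono_ae iV ((iα.mul_const _).add (iJ.const_mul (u * z ^ m))) (by
    filter_upwards [hA.ae_nonneg] with x hx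
    exact meanAfter_pow_le hμ.le hw.1 hu.le hu1 hz hx)
  have hlow := integral_mono_ae ((iα.mul_const
      (meanAfter m (m + n) μ w (fun j => z ^ (j : ℕ)) 0)).add (iαJ.const_mul u)) iV (by
    filter_upwards [hA.ae_nonneg] with x hx
    have := le_meanAfter_pow (m := m) hμ.le hw.1 hu.le hu1 hz hx
    simp only [Pi.add_apply]
    linear_combination this)
  simp only [Pi.add_apply] at hup hlow
  rw [hw.integral_meanAfter hA hμ.le, integral_add (iα.mul_const _) (iJ.const_mul (u * z ^ m)),
    integral_mul_const, integral_const_mul, hI, hV0] at hup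
  rw [hw.integral_meanAfter hA hμ.le, integral_add (iα.mul_const _) (iαJ.const_mul u),
    integral_mul_const, integral_const_mul, hV0] at hlow
  rw [hI] at hexp
  have hzN : 0 < z ^ (m + n) := by positivity
  have hzm : 1 ≤ z ^ m := one_le_pow₀ hz1
  rw [pow_succ] at hup hlow ⊢
  generalize ∫ x, Real.exp (-(u * (μ * m * x))) * idleMean m (m + n) μ w x ∂A = E at *
  generalize ∫ x, Real.exp (-(u * (μ * m * x))) ∂A = α at *
  generalize ∑ i, w i * z ^ (i : ℕ) = H at *
  generalize w (Fin.last (m + n)) = p at *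
  generalize normalizedMoment 3 m μ A = R at *
  generalize normalizedMoment 2 m μ A = R2 at *
  generalize (∫ x, x ∂A) = M at *
  generalize z ^ (m + n) = Z at *
  generalize z ^ m = Y at *
  -- the choice of `u` cancels the first two orders of the transform
  have hα2' : α ≤ 1 - u := by
    linear_combination hα2 + u * hδ + u / 2 * huδ
  have hα1' : 1 - u - u ^ 3 * R / 6 ≤ α := by
    linear_combination hα1 - u * hδ - u / 2 * huδ
  have hαz2 : α * z ≤ 1 := by
    calc α * z ≤ (1 - u) * z := by gcongr
      _ = 1 := by linarith
  have hαz1 : 1 - z * u ^ 3 * B / 6 ≤ α * z := by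
    calc 1 - z * u ^ 3 * B / 6 ≤ 1 - z * u ^ 3 * R / 6 := by gcongr
      _ = (1 - u - u ^ 3 * R / 6) * z := by linear_combination -hz
      _ ≤ α * z := by gcongr
  have hB0 : 0 ≤ B := hR0.trans hB
  have hzu : z - 1 = u * z := by linear_combination hz
  have hI0 : 0 ≤ δ + p := by positivity
  have hRB : u * R / K ≤ u * B / K := by gcongr
  have hcu : Z * z * u ^ 3 * B / 6 ≤ Z * z * u ^ 2 * B / 6 := by
    have : u ^ 3 ≤ u ^ 2 := pow_le_pow_of_le_one hu.le hu1.le (by norm_num)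
    gcongr
  -- both halves, divided by `u`
  have upper : α * z * (Z * p) ≤ Y * (δ + p) := by
    refine le_of_mul_le_mul_left ?_ hu
    have h1 : (α * z - 1) * H ≤ 0 := mul_nonpos_of_nonpos_of_nonneg (by linarith) hH0
    have h2 : u * (α * z * (Z * p)) = α * (p * (Z * z - Z)) := by
      linear_combination -(α * p * Z) * hzu
    rw [h2]
    linear_combination hup + h1
  have lower : (1 - u * K) * (δ + p) - u * B / K - Z * z * u ^ 2 * B / 6 ≤ α * z * (Z * p) := by
    refine le_of_mul_le_mul_left ?_ hu
    have h1 : -(Z * z * u ^ 3 * B / 6) ≤ (α * z - 1) * H := by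
      have h3 : (1 - α * z) * H ≤ z * u ^ 3 * B / 6 * Z := by
        gcongr
        linarith
      linear_combination h3
    have h2 : u * (α * z * (Z * p)) = α * (p * (Z * z - Z)) := by
      linear_combination -(α * p * Z) * hzu
    have h4 : u * ((1 - u * K) * (δ + p) - u * B / K) ≤ u * E :=
      mul_le_mul_of_nonneg_left (by linarith) hu.le
    rw [h2]
    linear_combination hlow + h1 + h4
  have hZp : 0 ≤ Z * p := by positivity
  have hsub : α * z * (Z * p) ≤ Z * p := mul_le_of_le_one_left hZp hαz2
  have hsup : Z * p ≤ α * z * (Z * p) + Z * z * u ^ 3 * B / 6 := by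
    have h3 : (1 - α * z) * (Z * p) ≤ z * u ^ 3 * B / 6 * (Z * 1) := by
      gcongr
      linarith
    linear_combination h3
  have hYI : 0 ≤ (Y - 1) * (δ + p) := mul_nonneg (by linarith) hI0
  have huKI : 0 ≤ u * K * (δ + p) := by positivity
  have huB : 0 ≤ u * B / K := by positivity
  rw [abs_le]
  constructor
  · linear_combination lower + hsub + hYI
  · linear_combination upper + hsup + hcu + huKI + huB

end Balance

/-! ### The limit -/

section Limit

theorem lossProb_nonneg {m n : ℕ} {μ : ℝ} {A : Measure ℝ} (hm : 1 ≤ m) (hA : IsInterarrivalLaw A)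
    (hμ : 0 < μ) : 0 ≤ lossProb m n μ A := by
  obtain ⟨w, hw, hp⟩ := exists_isStationaryLaw_lossProb (n := n) hm hA hμ
  exact hp ▸ hw.1.1 _

/-- The mean interarrival time in terms of the load. -/
theorem mul_integral_eq_of_load_eq {m : ℕ} {μ ε : ℝ} {A : Measure ℝ} (hm : 1 ≤ m)
    (hA : IsInterarrivalLaw A) (hμ : 0 < μ) (h : load m μ A = 1 - ε) :
    0 < 1 - ε ∧ μ * m * (∫ x, x ∂A) = (1 - ε)⁻¹ := by
  have hm' : (0 : ℝ) < m := by exact_mod_cast hm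
  have hM := hA.mean_pos
  have h' : 1 - ε = (μ * m * (∫ x, x ∂A))⁻¹ := by
    rw [← h, load, arrivalRate]
    field_simp
  rw [h', inv_inv]
  exact ⟨by positivity, rfl⟩

/-- The second moment is at least `2 E[S] - 1`, by `(S - 1) ^ 2 ≥ 0`. -/
theorem le_normalizedMoment_two {m : ℕ} {μ : ℝ} {A : Measure ℝ} (hA : IsInterarrivalLaw A)
    (h3 : Integrable (fun x : ℝ => x ^ 3) A) :
    2 * (μ * m * ∫ x, x ∂A) - 1 ≤ normalizedMoment 2 m μ A := by
  have := hA.isProbabilityMeasure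
  have i1 : Integrable (fun x : ℝ => 2 * (μ * m * x)) A := (hA.integrable.const_mul _).const_mul _
  have i0 := integrable_const (μ := A) (1 : ℝ)
  have e : 2 * (μ * m * ∫ x, x ∂A) - 1 = ∫ x, (2 * (μ * m * x) - 1) ∂A := by
    rw [integral_sub i1 i0, integral_const_mul, integral_const_mul]
    simp
  rw [e]
  refine integral_mono (i1.sub i0) (integrable_normalized_pow (hA.integrable_sq h3)) fun x => ?_
  nlinarith [sq_nonneg (μ * m * x - 1)]

/-- The exponential quotient `(exp y - 1) / y`, continued by `1` at `0`. -/
theorem dslope_exp_zero_of_ne {y : ℝ} (hy : y ≠ 0) :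
    dslope Real.exp 0 y = (Real.exp y - 1) / y := by
  rw [dslope_of_ne _ hy, slope_def_field, Real.exp_zero, sub_zero]

theorem dslope_exp_zero_self : dslope Real.exp 0 0 = 1 := by
  rw [dslope_same, Real.deriv_exp, Real.exp_zero]

theorem continuousAt_dslope_exp_zero (y : ℝ) : ContinuousAt (dslope Real.exp 0) y := by
  rcases eq_or_ne y 0 with rfl | hy
  · exact continuousAt_dslope_same.2 Real.differentiableAt_exp
  · exact (continuousAt_dslope_of_ne hy).2 Real.continuous_exp.continuousAt

/-- The growth of `(1 - u) ^ (-(m + n))`, on the scale of `n u`, where `u → 0` and `n u → κ`. -/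
theorem tendsto_pow_sub_one_div {u z : ℕ → ℝ} {κ : ℝ} (m : ℕ) (hu : ∀ᶠ n in atTop, 0 < u n)
    (hu0 : Tendsto u atTop (𝓝 0)) (hnu : Tendsto (fun n : ℕ => n * u n) atTop (𝓝 κ))
    (hz : ∀ᶠ n in atTop, z n * (1 - u n) = 1) :
    Tendsto (fun n : ℕ => (z n ^ (m + n) - 1) / (n * u n)) atTop (𝓝 (dslope Real.exp 0 κ)) := by
  have hu1 : ∀ᶠ n in atTop, u n < 1 := hu0.eventually_lt_const one_pos
  -- `y / (n u)` lies between `(m + n) / n` and `(m + n) / n` times `(1 - u)⁻¹`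
  set y : ℕ → ℝ := fun n => (m + n : ℕ) * (-Real.log (1 - u n)) with hy
  have hmn : Tendsto (fun n : ℕ => ((m + n : ℕ) : ℝ) / n) atTop (𝓝 1) := by
    have h : Tendsto (fun n : ℕ => (m : ℝ) / n + 1) atTop (𝓝 (0 + 1)) :=
      (tendsto_const_div_atTop_nhds_zero_nat (m : ℝ)).add_const 1
    rw [zero_add] at h
    refine h.congr' ?_
    filter_upwards [eventually_gt_atTop 0] with n hn
    have : (n : ℝ) ≠ 0 := by positivity
    push_cast
    field_simp
  have hinv : Tendsto (fun n => (1 - u n)⁻¹) atTop (𝓝 1) := by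
    simpa using (hu0.const_sub 1).inv₀ (by norm_num)
  have hratio : Tendsto (fun n : ℕ => y n / (n * u n)) atTop (𝓝 1) := by
    have hub := hmn.mul hinv
    rw [one_mul] at hub
    refine tendsto_of_tendsto_of_tendsto_of_le_of_le' hmn hub ?_ ?_
    · filter_upwards [hu, hu1, eventually_gt_atTop 0] with n h0 h1 hn
      have hn' : (0 : ℝ) < n := by positivity
      rw [div_le_div_iff₀ hn' (by positivity)]
      have := Real.log_le_sub_one_of_pos (sub_pos.2 h1)
      calc ((m + n : ℕ) : ℝ) * (n * u n) = ((m + n : ℕ) : ℝ) * u n * n := by ring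
        _ ≤ ((m + n : ℕ) : ℝ) * (-Real.log (1 - u n)) * n := by
          gcongr
          linarith
    · filter_upwards [hu, hu1, eventually_gt_atTop 0] with n h0 h1 hn
      have hn' : (0 : ℝ) < n := by positivity
      have h1' := sub_pos.2 h1
      have := Real.one_sub_inv_le_log_of_pos h1'
      have hle : -Real.log (1 - u n) ≤ (1 - u n)⁻¹ * u n := by
        have : (1 - u n)⁻¹ * u n = (1 - u n)⁻¹ - 1 := by field_simp; ring
        linarith
      rw [div_le_iff₀ (by positivity)]
      calc y n ≤ ((m + n : ℕ) : ℝ) * ((1 - u n)⁻¹ * u n) := by simp only [hy]; gcongr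
        _ = _ := by field_simp
  have hylim : Tendsto y atTop (𝓝 κ) := by
    have h := hratio.mul hnu
    rw [one_mul] at h
    refine h.congr' ?_
    filter_upwards [hu, eventually_gt_atTop 0] with n h0 hn
    have : (n : ℝ) ≠ 0 := by positivity
    field_simp
  have h := ((continuousAt_dslope_exp_zero κ).tendsto.comp hylim).mul hratio
  rw [mul_one] at h
  refine h.congr' ?_
  filter_upwards [hu, hu1, hz, eventually_gt_atTop 0] with n h0 h1 h2 hn
  have h1' := sub_pos.2 h1
  have hlog : Real.log (1 - u n) < 0 := Real.log_neg h1' (by linarith)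
  have hy0 : 0 < y n := mul_pos (by positivity) (by linarith)
  have hexp : Real.exp (y n) = z n ^ (m + n) := by
    rw [hy, Real.exp_nat_mul, Real.exp_neg, Real.exp_log h1', eq_inv_of_mul_eq_one_left h2]
  simp only [Function.comp_apply]
  rw [dslope_exp_zero_of_ne hy0.ne', hexp]
  field_simp

/-- A sequence that nearly solves `q l = 1`, with an error that may involve `q` itself. -/
theorem tendsto_inv_of_abs_mul_sub_one_le {q l a b : ℕ → ℝ} {L : ℝ} (hL : 0 < L)
    (hl : Tendsto l atTop (𝓝 L)) (ha : Tendsto a atTop (𝓝 0)) (hb : Tendsto b atTop (𝓝 0))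
    (h : ∀ᶠ n in atTop, |q n * l n - 1| ≤ a n + b n * q n) : Tendsto q atTop (𝓝 L⁻¹) := by
  have hm : Tendsto (fun n => l n - b n) atTop (𝓝 L) := by simpa using hl.sub hb
  have hp : Tendsto (fun n => l n + b n) atTop (𝓝 L) := by simpa using hl.add hb
  have hlo : Tendsto (fun n => (1 - a n) / (l n + b n)) atTop (𝓝 L⁻¹) := by
    simpa [Pi.div_def] using (ha.const_sub 1).div hp hL.ne'
  have hup : Tendsto (fun n => (1 + a n) / (l n - b n)) atTop (𝓝 L⁻¹) := by
    simpa [Pi.div_def] using (ha.const_add 1).div hm hL.ne'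
  refine tendsto_of_tendsto_of_tendsto_of_le_of_le' hlo hup ?_ ?_
  · filter_upwards [h, hp.eventually_const_lt hL] with n hn hpos
    rw [div_le_iff₀ hpos]
    linarith [(abs_le.1 hn).1]
  · filter_upwards [h, hm.eventually_const_lt hL] with n hn hpos
    rw [le_div_iff₀ hpos]
    linarith [(abs_le.1 hn).2]

theorem dslope_exp_zero_pos {y : ℝ} (hy : 0 ≤ y) : 0 < dslope Real.exp 0 y := by
  rcases hy.eq_or_lt with rfl | hy
  · rw [dslope_exp_zero_self]; exact one_pos
  · rw [dslope_exp_zero_of_ne hy.ne']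
    exact div_pos (sub_pos.2 (Real.one_lt_exp_iff.2 hy)) hy

/-- Both regimes at once: `n p` converges to `ϱ₂ / 2` divided by the exponential quotient at
`2 C / ϱ₂`. -/
theorem tendsto_lossProb_mul (m : ℕ) (hm : 1 ≤ m)
    (A : ℕ → Measure ℝ) (μ : ℕ → ℝ) (ε : ℕ → ℝ) (C ρ₂ : ℝ)
    (hA : ∀ n, IsInterarrivalLaw (A n)) (hμ : ∀ n, 0 < μ n)
    (hload : ∀ n, load m (μ n) (A n) = 1 - ε n)
    (hε : ∀ n, 0 < ε n) (hε0 : Tendsto ε atTop (𝓝 0))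
    (hC : Tendsto (fun n : ℕ => ε n * n) atTop (𝓝 C))
    (hint : ∀ n, Integrable (fun x : ℝ => x ^ 3) (A n))
    (hbdd : ∃ B : ℝ, ∀ n, normalizedMoment 3 m (μ n) (A n) ≤ B)
    (hρ₂ : Tendsto (fun n => normalizedMoment 2 m (μ n) (A n)) atTop (𝓝 ρ₂)) :
    0 < ρ₂ ∧ Tendsto (fun n : ℕ => lossProb m n (μ n) (A n) * n) atTop
      (𝓝 (ρ₂ / 2 * (dslope Real.exp 0 (2 * C / ρ₂))⁻¹)) := by
  obtain ⟨B, hB⟩ := hbdd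
  have hmean := fun n => mul_integral_eq_of_load_eq hm (hA n) (hμ n) (hload n)
  have hR1 : ∀ n, 1 ≤ normalizedMoment 2 m (μ n) (A n) := fun n => by
    have h1 := le_normalizedMoment_two (m := m) (μ := μ n) (hA n) (hint n)
    have h2 : 1 ≤ (1 - ε n)⁻¹ := (one_le_inv₀ (hmean n).1).2 (by linarith [hε n])
    rw [(hmean n).2] at h1
    linarith
  have hρ0 : 0 < ρ₂ := one_pos.trans_le (ge_of_tendsto' hρ₂ hR1)
  refine ⟨hρ0, ?_⟩
  set R : ℕ → ℝ := fun n => normalizedMoment 2 m (μ n) (A n) with hR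
  have hRpos : ∀ n, 0 < R n := fun n => one_pos.trans_le (hR1 n)
  set δ : ℕ → ℝ := fun n => (1 - ε n)⁻¹ - 1 with hδ
  have hinv : Tendsto (fun n => (1 - ε n)⁻¹) atTop (𝓝 1) := by
    simpa using (hε0.const_sub 1).inv₀ (by norm_num)
  have hδε : ∀ n, δ n = ε n * (1 - ε n)⁻¹ := fun n => by
    have := (hmean n).1.ne'
    simp only [hδ]
    field_simp
    ring
  have hδpos : ∀ n, 0 < δ n := fun n => by
    rw [hδε]
    exact mul_pos (hε n) (inv_pos.2 (hmean n).1)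
  set u : ℕ → ℝ := fun n => 2 * δ n / R n with hu
  have hupos : ∀ n, 0 < u n := fun n => div_pos (mul_pos two_pos (hδpos n)) (hRpos n)
  have hu0 : Tendsto u atTop (𝓝 0) := by
    simpa [hu, hδ, Pi.div_def] using ((hinv.sub_const 1).const_mul 2).div hρ₂ hρ0.ne'
  have hnu : Tendsto (fun n : ℕ => n * u n) atTop (𝓝 (2 * C / ρ₂)) := by
    have h := ((hC.mul hinv).const_mul 2).div hρ₂ hρ0.ne'
    rw [mul_one] at h
    refine h.congr fun n => ?_
    simp only [hu, hδε, Pi.div_apply]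
    ring
  have hu1 : ∀ᶠ n in atTop, u n < 1 := hu0.eventually_lt_const one_pos
  set z : ℕ → ℝ := fun n => (1 - u n)⁻¹ with hz
  have hzu : ∀ᶠ n in atTop, z n * (1 - u n) = 1 := by
    filter_upwards [hu1] with n hn
    exact inv_mul_cancel₀ (sub_pos.2 hn).ne'
  have hz1 : Tendsto z atTop (𝓝 1) := by
    simpa using (hu0.const_sub 1).inv₀ (by norm_num)
  have hC0 : 0 ≤ C := ge_of_tendsto' hC fun n => mul_nonneg (hε n).le (Nat.cast_nonneg n)
  have hL := dslope_exp_zero_pos (y := 2 * C / ρ₂) (by positivity)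
  have hl := tendsto_pow_sub_one_div m (Eventually.of_forall hupos) hu0 hnu hzu
  have hsqrt : Tendsto (fun n : ℕ => Real.sqrt n) atTop atTop :=
    Real.tendsto_sqrt_atTop.comp tendsto_natCast_atTop_atTop
  have hzpow : Tendsto (fun n => z n ^ (m + n)) atTop
      (𝓝 (dslope Real.exp 0 (2 * C / ρ₂) * (2 * C / ρ₂) + 1)) := by
    refine ((hl.mul hnu).add_const 1).congr' ?_
    filter_upwards [eventually_gt_atTop 0] with n hn
    have hn' : (n : ℝ) ≠ 0 := by positivity
    have := (hupos n).ne'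
    field_simp
    ring
  -- the coefficient of the loss probability in the error
  set b : ℕ → ℝ := fun n => m * z n ^ m / n + (Real.sqrt n)⁻¹ with hb_def
  have hb : Tendsto b atTop (𝓝 0) := by
    have h1 : Tendsto (fun n : ℕ => m * z n ^ m / (n : ℝ)) atTop (𝓝 0) :=
      ((hz1.pow m).const_mul (m : ℝ)).div_atTop tendsto_natCast_atTop_atTop
    simpa using h1.add hsqrt.inv_tendsto_atTop
  set a : ℕ → ℝ := fun n => z n ^ (m + n) * z n * u n * (2 / R n) * B / 6 + b n * (n * u n) +
    2 / R n * B * (Real.sqrt n)⁻¹ with ha_def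
  have ha : Tendsto a atTop (𝓝 0) := by
    have hR2 : Tendsto (fun n => 2 / R n) atTop (𝓝 (2 / ρ₂)) :=
      tendsto_const_nhds.div hρ₂ hρ0.ne'
    have h1 := ((((hzpow.mul hz1).mul hu0).mul hR2).mul_const B).div_const 6
    have h2 := hb.mul hnu
    have h3 := (hR2.mul_const B).mul hsqrt.inv_tendsto_atTop
    simpa using (h1.add h2).add h3
  have hq : Tendsto (fun n : ℕ => lossProb m n (μ n) (A n) * n * (2 / R n)) atTop
      (𝓝 (dslope Real.exp 0 (2 * C / ρ₂))⁻¹) := by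
    refine tendsto_inv_of_abs_mul_sub_one_le hL hl ha hb ?_
    filter_upwards [hu1, hzu, eventually_gt_atTop 0] with n hn1 hzn hn
    have hn' : (0 : ℝ) < n := by positivity
    have hs : 0 < Real.sqrt n := Real.sqrt_pos.2 hn'
    have hss : Real.sqrt n * Real.sqrt n = n := Real.mul_self_sqrt hn'.le
    have huR : u n * R n = 2 * δ n := div_mul_cancel₀ _ (hRpos n).ne'
    have hmain := abs_loss_balance_le (n := n) hm (hA n) (hμ n) (hint n) (δ := δ n) (u := u n)
      (by rw [(hmean n).2]) (hδpos n).le (hupos n) hn1 huR hzn hs (hB n)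
    have hp0 := lossProb_nonneg (n := n) hm (hA n) (hμ n)
    have hz1' := one_le_of_mul_one_sub (hupos n).le hn1 hzn
    -- Bernoulli's inequality for `1 - u`
    have hY : z n ^ m - 1 ≤ u n * (m * z n ^ m) := by
      have h := one_add_mul_le_pow (a := -u n) (by linarith) m
      have h2 : z n ^ m * (1 + -u n) ^ m = 1 := by
        rw [← mul_pow, ← sub_eq_add_neg, hzn, one_pow]
      have h3 := mul_le_mul_of_nonneg_left h (show 0 ≤ z n ^ m by positivity)
      linarith
    have hδu : δ n = u n * R n / 2 := by linarith
    have hRn := hRpos n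
    have hun := hupos n
    have hδn := hδpos n
    rw [pow_succ] at hmain
    generalize lossProb m n (μ n) (A n) = p at *
    have hstep : (z n ^ m - 1 + u n * Real.sqrt n) * (δ n + p) ≤
        (u n * (m * z n ^ m) + u n * Real.sqrt n) * (δ n + p) := by gcongr
    have e1 : p * n * (2 / R n) * ((z n ^ (m + n) - 1) / (n * u n)) - 1 =
        (z n ^ (m + n) * p - (δ n + p)) / δ n := by
      rw [hδu]; field_simp; ring
    rw [e1, abs_div, abs_of_pos hδn, div_le_iff₀ hδn]
    refine hmain.trans ((add_le_add_left (add_le_add_right hstep _) _).trans_eq ?_)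
    simp only [ha_def, hb_def]
    have hsn : (Real.sqrt n)⁻¹ = Real.sqrt n / n := by
      field_simp
      linarith
    rw [div_eq_mul_inv (u n * B), hsn, hδu]
    field_simp
    ring
  have h := (hρ₂.div_const 2).mul hq
  refine h.congr fun n => ?_
  have := (hRpos n).ne'
  simp only [hR] at this ⊢
  field_simp

end Limit

end GIMmn

/-- For `n = 0, 1, …` the `n`-th system is a `GI/M/m/n` queue with interarrival law `A n` and
service rate `μ n`; the number `m` of servers is fixed. -/
theorem theorem2 (m : ℕ) (hm : 1 ≤ m)
    (A : ℕ → Measure ℝ) (μ : ℕ → ℝ) (ε : ℕ → ℝ) (C ρ₂ : ℝ)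
    (hA : ∀ n, GIMmn.IsInterarrivalLaw (A n)) (hμ : ∀ n, 0 < μ n)
    (hload : ∀ n, GIMmn.load m (μ n) (A n) = 1 - ε n)
    (hε : ∀ n, 0 < ε n) (hε0 : Tendsto ε atTop (𝓝 0))
    (hC : Tendsto (fun n : ℕ => ε n * n) atTop (𝓝 C))
    (hint : ∀ n, Integrable (fun x : ℝ => x ^ 3) (A n))
    (hbdd : ∃ B : ℝ, ∀ n, GIMmn.normalizedMoment 3 m (μ n) (A n) ≤ B)
    (hρ₂ : Tendsto (fun n => GIMmn.normalizedMoment 2 m (μ n) (A n)) atTop (𝓝 ρ₂)) :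
    (∀ n, ∃! w, GIMmn.IsStationaryLaw (GIMmn.transitionMatrix m n (μ n) (A n)) w) ∧
    (0 < C → Asymptotics.IsEquivalent atTop
      (fun n => GIMmn.lossProb m n (μ n) (A n))
      (fun n => ε n * Real.exp (-2 * C / ρ₂) / (1 - Real.exp (-2 * C / ρ₂)))) ∧
    (C = 0 → Asymptotics.IsLittleO atTop
      (fun n : ℕ => GIMmn.lossProb m n (μ n) (A n) - ρ₂ / (2 * n))
      (fun n : ℕ => 1 / (n : ℝ))) := by
  obtain ⟨hρ0, hlim⟩ := GIMmn.tendsto_lossProb_mul m hm A μ ε C ρ₂ hA hμ hload hε hε0 hC hint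
    hbdd hρ₂
  refine ⟨fun n => GIMmn.existsUnique_isStationaryLaw_transitionMatrix hm (hA n) (hμ n),
    fun hC0 => ?_, fun hC0 => ?_⟩
  · have hκ : 0 < 2 * C / ρ₂ := by positivity
    have hexp : 1 < Real.exp (2 * C / ρ₂) := Real.one_lt_exp_iff.2 hκ
    have hval : ρ₂ / 2 * (dslope Real.exp 0 (2 * C / ρ₂))⁻¹ / C =
        Real.exp (-2 * C / ρ₂) / (1 - Real.exp (-2 * C / ρ₂)) := by
      have h1 : Real.exp (2 * C / ρ₂) - 1 ≠ 0 := (sub_pos.2 hexp).ne'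
      rw [GIMmn.dslope_exp_zero_of_ne hκ.ne', show -2 * C / ρ₂ = -(2 * C / ρ₂) by ring,
        Real.exp_neg]
      have h2 : 1 - (Real.exp (2 * C / ρ₂))⁻¹ ≠ 0 :=
        (sub_pos.2 (inv_lt_one_of_one_lt₀ hexp)).ne'
      generalize Real.exp (2 * C / ρ₂) = E at *
      have hE : E ≠ 0 := by positivity
      field_simp
    have hne : Real.exp (-2 * C / ρ₂) / (1 - Real.exp (-2 * C / ρ₂)) ≠ 0 := by
      rw [← hval]
      have := GIMmn.dslope_exp_zero_pos hκ.le
      positivity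
    have hq := hlim.div hC hC0.ne'
    rw [hval] at hq
    have heq := (Asymptotics.IsEquivalent.refl (u := ε) (l := atTop)).mul
      ((Asymptotics.isEquivalent_const_iff_tendsto hne).2 hq)
    refine (heq.congr_left ?_).congr_right ?_
    · filter_upwards [eventually_gt_atTop 0] with n hn
      have : (n : ℝ) ≠ 0 := by positivity
      have := (hε n).ne'
      simp only [Pi.mul_apply, Pi.div_apply]
      field_simp
    · exact Eventually.of_forall fun n => by
        simp only [Pi.mul_apply, Function.const_apply]; ring
  · subst hC0
    rw [mul_zero, zero_div, GIMmn.dslope_exp_zero_self, inv_one, mul_one] at hlim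
    rw [Asymptotics.isLittleO_iff_tendsto' (by
      filter_upwards [eventually_gt_atTop 0] with n hn h
      have : (n : ℝ) ≠ 0 := by positivity
      simp [this] at h)]
    have h := hlim.sub_const (ρ₂ / 2)
    rw [sub_self] at h
    refine h.congr' ?_
    filter_upwards [eventually_gt_atTop 0] with n hn
    have : (n : ℝ) ≠ 0 := by positivity
    field_simp
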